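/- Let $\Sigma$ be a finite alphabet. A nonempty word $w=w_1\cdots w_n\in\Sigma^+$ is represented by the structure $\langle w\rangle$ with domain $[1,n]$, unary predicates $Q_s$ ($s\in\Sigma$), $\mathtt{min}$, $\mathtt{max}$, where $Q_s(i)\iff w_i=s$, $\mathtt{min}(i)\iff i=1$, $\mathtt{max}(i)\iff i=n$, the natural order, and the unary functions $\mathtt{suc}(i)=\min(i+1,n)$, $\mathtt{pred}(i)=\max(i-1,1)$; for $k\ge 0$ write $x+k=\mathtt{suc}^k(x)$ and $x-k=\mathtt{pred}^k(x)$. An inclusion Horn formula is a formula $\exists\mathbf R\,\forall x\,\forall y\,\psi(x,y)$, where $\mathbf R$ is a finite set of binary predicates and $\psi$ is a finite conjunction of clauses $x\le y\wedge\delta_1\wedge\dots\wedge\delta_r\to\delta_0$ ($r\ge 0$), in which $\delta_0$ is $R(x,y)$ with $R\in\mathbf R$, or $\bot$ (False), and each $\delta_i$ ($1\le i\le r$) is 1. an input literal $U(x+a)$, $\neg U(x+a)$, $U(y+a)$ or $\neg U(y+a)$ with $U\in\{(Q_s)_{s\in\Sigma},\mathtt{min},\mathtt{max}\}$ and $a\in\mathbb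 Z$; or 2. $x=y$ or $x<y$; or 3. a conjunction $S(x+a,y-b)\wedge x+a\le y-b$ with $S\in\mathbf R$ and integers $a,b\ge 0$. Such a formula $\Phi$ defines the language $\{w\in\Sigma^+ : \langle w\rangle\models\Phi\}$; let $\mathtt{incl}$-$\mathtt{ESO}$-$\mathtt{HORN}$ be the class of languages over $\Sigma$ defined in this way. A trellis automaton consists of a finite set of states $Q\supseteq\Sigma$, a set $Q_{accept}\subseteq Q$ and a map $\delta:Q^2\to Q$. Its final state on a one-letter word $s$ is $s$, and its final state on $w_1\cdots w_n$ with $n\ge 2$ is $\delta(q_1,q_2)$, where $q_1$ and $q_2$ are its final states on $w_1\cdots w_{n-1}$ and on $w_2\cdots w_n$. It accepts the words of $\Sigma^+$ on which its final state is in $Q_{accept}$. Let $\mathtt{Trellis}$ be the class of languages over $\Sigma$ accepted by trellis automata. A one-way cellular automaton (OCA) consists of a finite set of states $Q\supseteq\Sigma$, a border state $\sharp\in Q\setminus\Sigma$, a set $Q_{accept}\subseteq Q$ and a map $\delta:Q^2\to Q$. On an input $w\in\Sigma^n$, $n\ge1$, the cells $c\in\mathbb{Z}\setminus[1,n]$ are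 always in the state $\sharp$, the cell $c\in[1,n]$ has the state $\langle c,1\rangle=w_c$ at time $1$ and $\langle c,t\rangle=\delta(\langle c-1,t-1\rangle,\langle c,t-1\rangle)$ at time $t>1$; the input is accepted in real time if $\langle n,n\rangle\in Q_{accept}$. Let $\mathtt{RealTime}_{\mathtt{OCA}}$ be the class of languages over $\Sigma$ accepted in real time by OCA. **Theorem.** For every finite alphabet $\Sigma$, $\mathtt{incl}$-$\mathtt{ESO}$-$\mathtt{HORN}=\mathtt{Trellis}=\mathtt{RealTime}_{\mathtt{OCA}}$. -/

import Mathlib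

universe u

/-! ### The structure encoding a nonempty word

The domain `[1, n]` is represented by `Fin n`: the position `i` of the word is the
element `i - 1` of `Fin n`. -/

namespace WordStructure

variable {n : ℕ}

/-- Successor function, with `suc n = n` on the last position. -/
def suc (i : Fin n) : Fin n := if h : i.val + 1 < n then ⟨i.val + 1, h⟩ else i

/-- Predecessor function, with `pred 1 = 1` on the first position. -/
def pred (i : Fin n) : Fin n := ⟨i.val - 1, lt_of_le_of_lt (Nat.sub_le _ _) i.isLt⟩

/-- The term `i + a`, for an integer `a`: it stands for `suc^a (i)` if `a ≥ 0`
and for `pred^(-a) (i)` if `a < 0`. -/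
def shift (a : ℤ) (i : Fin n) : Fin n :=
  if 0 ≤ a then suc^[a.toNat] i else pred^[(-a).toNat] i

end WordStructure

/-! ### Inclusion Horn formulas -/

/-- The two first-order variables. -/
inductive FOVar where
  | x
  | y

/-- The input predicates: `Q_s` for a letter `s`, `min` and `max`. -/
inductive InputPred (α : Type u) where
  | letter (s : α)
  | min
  | max

/-- The hypotheses, besides `x ≤ y`, of the clauses of inclusion Horn formulas over the alphabet
`α` and the set `R` of computation predicates. -/
inductive InclHyp (α R : Type u) where
  /-- the literal `U(v + a)` -/
  | pos (U : InputPred α) (v : FOVar) (a : ℤ)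
  /-- the literal `¬ U(v + a)` -/
  | neg (U : InputPred α) (v : FOVar) (a : ℤ)
  /-- the equality `x = y` -/
  | eq
  /-- the inequality `x < y` -/
  | lt
  /-- the conjunction `S(x + a, y - b) ∧ x + a ≤ y - b` -/
  | comp (S : R) (a b : ℕ)

/-- The conclusion of a clause: a computation atom `S(x, y)`, or `⊥`. -/
inductive InclConcl (R : Type u) where
  | atom (S : R)
  | bot

/-- A clause `x ≤ y ∧ δ₁ ∧ … ∧ δᵣ → δ₀`. -/
structure InclClause (α R : Type u) where
  hyps : List (InclHyp α R)
  concl : InclConcl R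

/-- An inclusion Horn formula `∃ R ∀ x ∀ y ψ(x, y)`: `R` is a finite set of binary predicates
and `ψ` is a (finite) conjunction of clauses. -/
structure InclFormula (α : Type u) where
  R : Type u
  finite_R : Finite R
  clauses : List (InclClause α R)

section Semantics

open WordStructure

variable {α R : Type u}

/-- Value of a variable when `x`, `y` are interpreted by the positions `i`, `j`. -/
def FOVar.val {n : ℕ} (i j : Fin n) : FOVar → Fin n
  | .x => i
  | .y => j

/-- Interpretation of the input predicates in the structure encoding `w`. -/
def InputPred.Holds (w : List α) (i : Fin w.length) : InputPred α → Prop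
  | .letter s => w.get i = s
  | .min => i.val = 0
  | .max => i.val + 1 = w.length

/-- Truth of a hypothesis at `(i, j)` when the computation predicates are interpreted by `I`. -/
def InclHyp.Holds (w : List α) (I : R → Fin w.length → Fin w.length → Prop)
    (i j : Fin w.length) : InclHyp α R → Prop
  | .pos U v a => U.Holds w (shift a (v.val i j))
  | .neg U v a => ¬ U.Holds w (shift a (v.val i j))
  | .eq => i = j
  | .lt => i < j
  | .comp S a b => I S (suc^[a] i) (pred^[b] j) ∧ suc^[a] i ≤ pred^[b] j

/-- Truth of a conclusion at `(i, j)`. -/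
def InclConcl.Holds {n : ℕ} (I : R → Fin n → Fin n → Prop) (i j : Fin n) : InclConcl R → Prop
  | .atom S => I S i j
  | .bot => False

/-- Truth of a clause at `(i, j)`. -/
def InclClause.Holds (w : List α) (I : R → Fin w.length → Fin w.length → Prop)
    (i j : Fin w.length) (C : InclClause α R) : Prop :=
  i ≤ j → (∀ h ∈ C.hyps, h.Holds w I i j) → C.concl.Holds I i j

/-- The structure encoding `w` satisfies the formula `Φ`. -/
def InclFormula.Holds (w : List α) (Φ : InclFormula α) : Prop :=
  ∃ I : Φ.R → Fin w.length → Fin w.length → Prop,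
    ∀ i j : Fin w.length, ∀ C ∈ Φ.clauses, C.Holds w I i j

/-- The language (of nonempty words) defined by an inclusion Horn formula. -/
def InclFormula.language (Φ : InclFormula α) : Language α :=
  {w : List α | w ≠ [] ∧ Φ.Holds w}

end Semantics

/-- The class of languages over `α` defined by inclusion Horn formulas. -/
def inclESOHorn (α : Type u) : Set (Language α) :=
  {L | ∃ Φ : InclFormula α, Φ.language = L}

/-! ### Cellular automata -/

/-- A one-dimensional cellular automaton with input alphabet `α` and neighborhood `N`.
The inclusion of the input alphabet into the set of states is `letter`; `border` is the
permanent state of the cells outside the input word. -/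
structure CellularAutomaton (α : Type u) (N : Finset ℤ) where
  Q : Type u
  finite_Q : Finite Q
  letter : α ↪ Q
  border : Q
  border_ne_letter : ∀ s : α, border ≠ letter s
  accept : Set Q
  δ : (N → Q) → Q

namespace CellularAutomaton

variable {α : Type u} {N : Finset ℤ}

/-- Initial state of the cell `c` with parallel input `w`: the cells `1, …, n` receive
the letters of `w`. -/
def init (A : CellularAutomaton α N) (w : List α) (c : ℤ) : A.Q :=
  if h : 1 ≤ c ∧ c ≤ w.length then A.letter (w.get ⟨(c - 1).toNat, by omega⟩) else A.border

/-- State of the cell `c` after `k` steps on the parallel input `w`, that is, at time `k + 1`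
(the initial time is `1`). The cells outside `[1, n]` stay in the permanent state. -/
def state (A : CellularAutomaton α N) (w : List α) : ℕ → ℤ → A.Q
  | 0, c => A.init w c
  | k + 1, c =>
    if 1 ≤ c ∧ c ≤ w.length then A.δ (fun v => A.state w k (c + (v : ℤ))) else A.border

end CellularAutomaton

/-- One-way cellular automata: the neighborhood is `{-1, 0}`. -/
abbrev OneWayCA (α : Type u) := CellularAutomaton α {-1, 0}

/-- The language (of nonempty words) accepted in real time by a one-way cellular automaton with
parallel input and the last cell as output cell. The last cell `n` has received all the
letters of a word of length `n` exactly after `n - 1` steps, that is, at time `n`. -/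
def OneWayCA.realTimeLanguage {α : Type u} (A : OneWayCA α) : Language α :=
  {w : List α | w ≠ [] ∧ A.state w (w.length - 1) (w.length : ℤ) ∈ A.accept}

/-- The class of languages over `α` accepted in real time by one-way cellular automata. -/
def RealTimeOCA (α : Type u) : Set (Language α) :=
  {L | ∃ A : OneWayCA α, A.realTimeLanguage = L}

/-! ### Trellis automata -/

/-- A trellis automaton with input alphabet `α`, included in the set `Q` of states. -/
structure TrellisAutomaton (α : Type u) where
  Q : Type u
  finite_Q : Finite Q
  letter : α ↪ Q
  accept : Set Q
  δ : Q → Q → Q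

/-- `A.Final w q`: the final state of the trellis automaton `A` acting on the word `w` is `q`.
It is the letter `w` itself if `w` has length `1`; otherwise it is `δ q₁ q₂`, where `q₁` and `q₂`
are the final states of `A` on `w` without its last letter and on `w` without its first letter. -/
inductive TrellisAutomaton.Final {α : Type u} (A : TrellisAutomaton α) : List α → A.Q → Prop where
  | single (s : α) : A.Final [s] (A.letter s)
  | step (s t : α) (v : List α) (q₁ q₂ : A.Q) (h₁ : A.Final (s :: v) q₁)
      (h₂ : A.Final (v ++ [t]) q₂) : A.Final (s :: v ++ [t]) (A.δ q₁ q₂)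

/-- The language (of nonempty words) accepted by a trellis automaton. -/
def TrellisAutomaton.language {α : Type u} (A : TrellisAutomaton α) : Language α :=
  {w : List α | ∃ q ∈ A.accept, A.Final w q}

/-- The class of languages over `α` accepted by trellis automata. -/
def Trellis (α : Type u) : Set (Language α) :=
  {L | ∃ A : TrellisAutomaton α, A.language = L}

/-! ### Triangular computations -/

/-! All three models compute a value for each factor [i, j] of the word from the values for [i, j-1]
and [i+1, j]; `pyramid` is this common form.

For an OCA, the cell at the last position of a factor of k+1 letters has, after k steps, seen
exactly that factor, so real-time acceptance reads the apex of a pyramid; the border never enters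
(`OneWayCA.state_eq_pyramid`). Conversely, a fresh border state turns a trellis automaton into an
OCA.

A trellis automaton becomes a Horn formula with one predicate per state, q(x, y) meaning that q is
the final state on [x, y].

For the converse, a Horn formula holds iff the least model of its clauses with atomic conclusion
violates no clause with conclusion ⊥ (`InclFormula.holds_iff`). Let M bound the shifts. Attach to
(i, j) the windows around i and j, the atoms true at (i+a, j-b) for a, b ≤ M, and whether a conflict
occurs inside [i, j]. This finite information at (i, j) depends only on that at (i, j-1) and (i+1,
j): every other cell consulted lies in one of the two smaller triangles, and dependence of (i, j) on
itself is resolved by minimality (`SimilarCells.least`, `leastValue_eq_of_lt`). Hence it is computed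
by a pyramid whose base values depend on windows rather than on single letters. Windows are then
eliminated by letting states be functions of the unknown left and right contexts
(`mem_trellis_of_window`). -/

/-- The value at the factor `c i, …, c (i + k)` of the triangular computation with initial
values `f` and transition `δ`. -/
def pyramid {α Q : Type*} (f : α → Q) (δ : Q → Q → Q) (c : ℕ → α) : ℕ → ℕ → Q
  | 0, i => f (c i)
  | k + 1, i => δ (pyramid f δ c k i) (pyramid f δ c k (i + 1))

/-- `c` extends the word `w` to an infinite word. -/
def Extends {α : Type*} (c : ℕ → α) (w : List α) : Prop :=
  ∀ (i : ℕ) (h : i < w.length), w[i] = c i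

theorem exists_extends {α : Type*} {w : List α} (hw : w ≠ []) : ∃ c, Extends c w :=
  ⟨fun i => w[i]?.getD (w.head hw), fun i h => by simp [h]⟩

theorem Extends.eq_map_range {α : Type*} {c : ℕ → α} {w : List α} (hc : Extends c w) :
    w = (List.range' 0 w.length).map c := by
  apply List.ext_getElem
  · simp
  · intro i h _
    simp [hc i h]

theorem map_range'_succ_succ {α : Type*} (c : ℕ → α) (i k : ℕ) :
    (List.range' i (k + 2)).map c =
      c i :: (List.range' (i + 1) k).map c ++ [c (i + k + 1)] := by
  rw [List.range'_succ, List.range'_concat]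
  simp
  congr 1
  ring

theorem map_range'_cons {α : Type*} (c : ℕ → α) (i k : ℕ) :
    (List.range' i (k + 1)).map c = c i :: (List.range' (i + 1) k).map c := by
  rw [List.range'_succ, List.map_cons]

theorem map_range'_concat {α : Type*} (c : ℕ → α) (i k : ℕ) :
    (List.range' (i + 1) (k + 1)).map c =
      (List.range' (i + 1) k).map c ++ [c (i + k + 1)] := by
  rw [List.range'_concat]
  simp
  congr 1
  ring

namespace TrellisAutomaton

variable {α : Type u} (A : TrellisAutomaton α)

theorem final_pyramid (c : ℕ → α) (k : ℕ) : ∀ i,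
    A.Final ((List.range' i (k + 1)).map c) (pyramid A.letter A.δ c k i) := by
  induction k with
  | zero => intro i; exact Final.single _
  | succ k ih =>
    intro i
    rw [map_range'_succ_succ]
    refine Final.step _ _ _ _ _ ?_ ?_
    · rw [← map_range'_cons]; exact ih i
    · rw [← map_range'_concat]; exact ih (i + 1)

/-- This is the determinism of `Final`: a word of length at least two splits in only one way as a
first letter, a middle and a last letter. -/
theorem Final.eq_pyramid {A : TrellisAutomaton α} {u : List α} {q : A.Q} (h : A.Final u q)
    (c : ℕ → α) : ∀ k i, u = (List.range' i (k + 1)).map c →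
      q = pyramid A.letter A.δ c k i := by
  induction h with
  | single s =>
    intro k i h
    have hk : k = 0 := by simpa using (congrArg List.length h).symm
    subst hk
    simp only [zero_add, List.range'_one, List.map_cons, List.map_nil, List.cons.injEq,
      and_true] at h
    rw [h, pyramid]
  | step s t v q₁ q₂ h₁ h₂ ih₁ ih₂ =>
    intro k i h
    obtain ⟨k, rfl⟩ : ∃ m, k = m + 1 := by
      have hl := congrArg List.length h
      simp at hl
      exact ⟨v.length, by omega⟩
    rw [map_range'_succ_succ, List.cons_append, List.cons_append, List.cons.injEq] at h
    obtain ⟨rfl, h⟩ := h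
    obtain ⟨rfl, ht⟩ := List.append_inj' h rfl
    rw [pyramid, ← ih₁ k i (map_range'_cons c i k).symm,
      ← ih₂ k (i + 1) (by rw [map_range'_concat, ht])]

theorem ne_nil_of_mem_language {w : List α} (h : w ∈ A.language) : w ≠ [] := by
  rintro rfl
  obtain ⟨q, -, h⟩ := h
  generalize hu : ([] : List α) = u at h
  cases h <;> simp at hu

theorem mem_language_iff {w : List α} {c : ℕ → α} (hc : Extends c w) :
    w ∈ A.language ↔ w ≠ [] ∧ pyramid A.letter A.δ c (w.length - 1) 0 ∈ A.accept := by
  constructor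
  · rintro ⟨q, hq, h⟩
    have hw : w ≠ [] := A.ne_nil_of_mem_language ⟨q, hq, h⟩
    refine ⟨hw, ?_⟩
    have hl := List.length_pos_of_ne_nil hw
    rwa [← h.eq_pyramid c (w.length - 1) 0
      (by rw [Nat.sub_add_cancel hl]; exact hc.eq_map_range)]
  · rintro ⟨hw, h⟩
    refine ⟨_, h, ?_⟩
    have hl := List.length_pos_of_ne_nil hw
    have := A.final_pyramid c (w.length - 1) 0
    rwa [Nat.sub_add_cancel hl, ← hc.eq_map_range] at this

end TrellisAutomaton

/-! ### One-way cellular automata and trellis automata -/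

namespace OneWayCA

variable {α : Type u}

/-- The transition of a one-way cellular automaton as a binary operation. -/
def trans (A : OneWayCA α) (p q : A.Q) : A.Q := A.δ fun v => if v.1 = -1 then p else q

/-- Position i + k (from 0) is cell i + k + 1 (from 1). After k steps its state depends on cells i +
1, …, i + k + 1 only, all inside the word. -/
theorem state_eq_pyramid (A : OneWayCA α) {w : List α} {c : ℕ → α} (hc : Extends c w) (k : ℕ) :
    ∀ i, i + k < w.length → A.state w k ((i + k + 1 : ℕ) : ℤ) =
      pyramid A.letter A.trans c k i := by
  induction k with
  | zero =>
    intro i hi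
    have : 1 ≤ ((i + 0 + 1 : ℕ) : ℤ) ∧ ((i + 0 + 1 : ℕ) : ℤ) ≤ w.length := by omega
    simp only [CellularAutomaton.state, CellularAutomaton.init, pyramid]
    rw [dif_pos this]
    simp [hc i hi]
  | succ k ih =>
    intro i hi
    have : 1 ≤ ((i + (k + 1) + 1 : ℕ) : ℤ) ∧ ((i + (k + 1) + 1 : ℕ) : ℤ) ≤ w.length := by omega
    rw [CellularAutomaton.state, if_pos this, pyramid, ← ih i (by omega),
      ← ih (i + 1) (by omega), trans]
    congr 1
    funext ⟨v, hv⟩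
    rcases Finset.mem_insert.1 hv with rfl | hv
    · simp
      congr 1
    · obtain rfl := Finset.mem_singleton.1 hv
      simp
      congr 1
      ring

theorem mem_realTimeLanguage_iff (A : OneWayCA α) {w : List α} {c : ℕ → α} (hc : Extends c w) :
    w ∈ A.realTimeLanguage ↔
      w ≠ [] ∧ pyramid A.letter A.trans c (w.length - 1) 0 ∈ A.accept := by
  refine and_congr_right fun hw => ?_
  have hl := List.length_pos_of_ne_nil hw
  rw [← A.state_eq_pyramid hc (w.length - 1) 0 (by omega),
    show 0 + (w.length - 1) + 1 = w.length by omega]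

end OneWayCA

theorem pyramid_map {α Q Q' : Type*} {f : α → Q} {f' : α → Q'} {δ : Q → Q → Q}
    {δ' : Q' → Q' → Q'} (e : Q → Q') (hf : ∀ s, f' s = e (f s))
    (hδ : ∀ p q, δ' (e p) (e q) = e (δ p q)) (c : ℕ → α) (k : ℕ) :
    ∀ i, pyramid f' δ' c k i = e (pyramid f δ c k i) := by
  induction k with
  | zero => intro i; exact hf _
  | succ k ih => intro i; rw [pyramid, pyramid, ih, ih, hδ]

theorem realTimeOCA_subset_trellis (α : Type u) : RealTimeOCA α ⊆ Trellis α := by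
  rintro _ ⟨A, rfl⟩
  refine ⟨⟨A.Q, A.finite_Q, A.letter, A.accept, OneWayCA.trans A⟩, ?_⟩
  ext w
  by_cases hw : w = []
  · exact iff_of_false (fun h => TrellisAutomaton.ne_nil_of_mem_language _ h hw) fun h => h.1 hw
  · obtain ⟨c, hc⟩ := exists_extends hw
    rw [TrellisAutomaton.mem_language_iff _ hc, OneWayCA.mem_realTimeLanguage_iff _ hc]

/-- The one-way cellular automaton that simulates a trellis automaton. -/
def TrellisAutomaton.toOCA {α : Type u} (A : TrellisAutomaton α) : OneWayCA α where
  Q := Option A.Q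
  finite_Q := by have := A.finite_Q; infer_instance
  letter := A.letter.trans Function.Embedding.some
  border := none
  border_ne_letter _ := by simp
  accept := some '' A.accept
  δ φ := Option.map₂ A.δ (φ ⟨-1, by simp⟩) (φ ⟨0, by simp⟩)

theorem trellis_subset_realTimeOCA (α : Type u) : Trellis α ⊆ RealTimeOCA α := by
  rintro _ ⟨A, rfl⟩
  refine ⟨A.toOCA, ?_⟩
  ext w
  by_cases hw : w = []
  · exact iff_of_false (fun h => h.1 hw) fun h => A.ne_nil_of_mem_language h hw
  · obtain ⟨c, hc⟩ := exists_extends hw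
    rw [TrellisAutomaton.mem_language_iff _ hc, OneWayCA.mem_realTimeLanguage_iff _ hc,
      pyramid_map (f := A.letter) (f' := A.toOCA.letter) (δ := A.δ) (δ' := A.toOCA.trans) some
        (fun _ => rfl) (fun p q => by simp [OneWayCA.trans, TrellisAutomaton.toOCA])]
    exact and_congr_right fun _ => Function.Injective.mem_set_image (Option.some_injective _)

/-! ### From trellis automata to inclusion Horn formulas -/

open WordStructure

theorem WordStructure.val_suc {n : ℕ} (i : Fin n) :
    (suc i).val = if i.val + 1 < n then i.val + 1 else i.val := by
  unfold suc; split_ifs <;> rfl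

theorem WordStructure.val_pred {n : ℕ} (i : Fin n) : (pred i).val = i.val - 1 := rfl

theorem exists_list_range {ι β : Type*} [Finite ι] (f : ι → β) :
    ∃ l : List β, ∀ b, b ∈ l ↔ b ∈ Set.range f := by
  have := Fintype.ofFinite ι
  exact ⟨Finset.univ.toList.map f, by simp⟩

namespace TrellisAutomaton

variable {α : Type u} [Finite α] (A : TrellisAutomaton α)

/-- The clause that initializes the simulation at the letter `s`. -/
def letterClause (s : α) : InclClause α A.Q :=
  ⟨[.eq, .pos (.letter s) .x 0], .atom (A.letter s)⟩

/-- The clause that simulates the transition from the states `p.1` and `p.2`. -/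
def stepClause (p : A.Q × A.Q) : InclClause α A.Q :=
  ⟨[.lt, .comp p.1 0 1, .comp p.2 1 0], .atom (A.δ p.1 p.2)⟩

/-- The clause that excludes `q` as the final state. -/
def rejectClause (q : A.Q) : InclClause α A.Q :=
  ⟨[.pos .min .x 0, .pos .max .y 0, .comp q 0 0], .bot⟩

theorem exists_formula : ∃ Φ : InclFormula α, Φ.language = A.language := by
  have := A.finite_Q
  obtain ⟨l₁, h₁⟩ := exists_list_range A.letterClause
  obtain ⟨l₂, h₂⟩ := exists_list_range A.stepClause
  obtain ⟨l₃, h₃⟩ := exists_list_range fun q : {q // q ∉ A.accept} => A.rejectClause q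
  refine ⟨⟨A.Q, A.finite_Q, l₁ ++ l₂ ++ l₃⟩, ?_⟩
  ext w
  by_cases hw : w = []
  · exact iff_of_false (fun h => h.1 hw) fun h => A.ne_nil_of_mem_language h hw
  obtain ⟨c, hc⟩ := exists_extends hw
  have hl := List.length_pos_of_ne_nil hw
  rw [mem_language_iff _ hc]
  refine and_congr_right fun _ => ?_
  constructor
  · rintro ⟨I, hI⟩
    -- Any model must contain the true computation, because the letter and step clauses force it by
    -- induction on the length of the factor.
    have key : ∀ k i (h : i + k < w.length),
        I (pyramid A.letter A.δ c k i) ⟨i, by omega⟩ ⟨i + k, h⟩ := by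
      intro k
      induction k with
      | zero =>
        intro i h
        refine hI ⟨i, h⟩ ⟨i, h⟩ (A.letterClause (c i)) ?_ le_rfl ?_
        · simp [h₁]
        · simp [letterClause, InclHyp.Holds, InputPred.Holds, FOVar.val, shift, hc i h]
      | succ k ih =>
        intro i h
        refine hI ⟨i, by omega⟩ ⟨i + (k + 1), h⟩
          (A.stepClause (pyramid A.letter A.δ c k i, pyramid A.letter A.δ c k (i + 1)))
          (by simp [h₂]) (by simp) ?_
        have e₁ : pred (⟨i + (k + 1), h⟩ : Fin w.length) = ⟨i + k, by omega⟩ := by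
          ext; simp [val_pred]
        have e₂ : suc (⟨i, by omega⟩ : Fin w.length) = ⟨i + 1, by omega⟩ := by
          ext; simp [val_suc]; omega
        have := ih (i + 1) (by omega)
        simp only [show i + 1 + k = i + (k + 1) by omega] at this
        simp [stepClause, InclHyp.Holds, e₁, e₂, ih i (by omega), this]
    by_contra hna
    refine hI ⟨0, hl⟩ ⟨0 + (w.length - 1), by omega⟩ (A.rejectClause _)
      (List.mem_append_right _ ((h₃ _).2 ⟨⟨_, hna⟩, rfl⟩)) (by simp) ?_
    simp [rejectClause, InclHyp.Holds, InputPred.Holds, FOVar.val, shift]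
    have := key (w.length - 1) 0 (by omega)
    simp at this
    exact ⟨by omega, this⟩
  · intro hacc
    -- The intended model. For j < i the truncated difference gives a meaningless value, which is
    -- harmless since clauses are tested only when i ≤ j.
    refine ⟨fun q i j => q = pyramid A.letter A.δ c (j - i) i, fun i j C hC hij hh => ?_⟩
    rcases List.mem_append.1 hC with hC | hC
    · rcases List.mem_append.1 hC with hC | hC
      · obtain ⟨s, rfl⟩ := (h₁ _).1 hC
        simp [letterClause, InclHyp.Holds, InputPred.Holds, FOVar.val, shift] at hh
        obtain ⟨rfl, hs⟩ := hh
        simp [letterClause, InclConcl.Holds, pyramid, ← hs, hc i.1 i.2]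
      · obtain ⟨p, rfl⟩ := (h₂ _).1 hC
        simp [stepClause, InclHyp.Holds] at hh
        obtain ⟨hlt, ⟨hp₁, -⟩, hp₂, -⟩ := hh
        have hlt' : i.val < j.val := hlt
        have hj := j.2
        rw [val_pred] at hp₁
        -- The hypothesis x < y of the step clause ensures that neither the successor of i nor the
        -- predecessor of j is clamped.
        rw [val_suc, if_pos (by omega)] at hp₂
        obtain ⟨k, hk⟩ : ∃ k, j.val - i.val = k + 1 := ⟨j - i - 1, by omega⟩
        rw [show j.val - 1 - i.val = k by omega] at hp₁
        rw [show j.val - (i.val + 1) = k by omega] at hp₂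
        simp [stepClause, InclConcl.Holds, hk, pyramid, hp₁, hp₂]
    · obtain ⟨⟨q, hq⟩, rfl⟩ := (h₃ _).1 hC
      simp [rejectClause, InclHyp.Holds, InputPred.Holds, FOVar.val, shift] at hh
      obtain ⟨hi, hj, hq', -⟩ := hh
      rw [show j.val - i.val = w.length - 1 by omega, hi] at hq'
      exact hq (hq' ▸ hacc)

end TrellisAutomaton

/-! ### Windows -/

section Windows

variable {α : Type u}

/-- The letter at position `z` of `w`, if there is one. -/
def look (w : List α) (z : ℤ) : Option α := if 0 ≤ z then w[z.toNat]? else none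

theorem look_natCast (w : List α) (i : ℕ) : look w i = w[i]? := by simp [look]

theorem look_eq_none_iff {w : List α} {z : ℤ} : look w z = none ↔ z < 0 ∨ w.length ≤ z := by
  unfold look
  split_ifs with h
  · simp; omega
  · simp; omega

/-- The `K` letters preceding position `i`, from right to left. -/
def leftWindow (K : ℕ) (w : List α) (i : ℕ) : Fin K → Option α :=
  fun d => look w ((i : ℤ) - 1 - (d : ℕ))

/-- The `K` letters following position `i`. -/
def rightWindow (K : ℕ) (w : List α) (i : ℕ) : Fin K → Option α :=
  fun d => look w ((i : ℤ) + 1 + (d : ℕ))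

/-- The neighborhood of radius `K` of a position. -/
abbrev Window (α : Type u) (K : ℕ) : Type u :=
  (Fin K → Option α) × Option α × (Fin K → Option α)

/-- The neighborhood of radius `K` of the position `i` in `w`. -/
def window (K : ℕ) (w : List α) (i : ℕ) : Window α K :=
  (leftWindow K w i, look w i, rightWindow K w i)

/-- Adds a letter at the front of a list of `K` optional letters, forgetting the last one. -/
def push {K : ℕ} (s : α) (l : Fin K → Option α) : Fin K → Option α :=
  fun d => if d.val = 0 then some s else l ⟨d.val - 1, by omega⟩

/-- Both contexts list the nearest letter first, so a single `push` extends either of them when the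
factor shrinks on that side. -/
theorem push_leftWindow {K : ℕ} {w : List α} {c : ℕ → α} (hc : Extends c w) {i : ℕ}
    (hi : i < w.length) : push (c i) (leftWindow K w i) = leftWindow K w (i + 1) := by
  funext d
  simp only [push, leftWindow]
  split_ifs with hd
  · rw [hd, show ((i + 1 : ℕ) : ℤ) - 1 - (0 : ℕ) = (i : ℕ) by omega, look_natCast]
    simp [hi, hc i hi]
  · congr 1; push_cast; omega

theorem push_rightWindow {K : ℕ} {w : List α} {c : ℕ → α} (hc : Extends c w) {i : ℕ}
    (hi : i + 1 < w.length) :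
    push (c (i + 1)) (rightWindow K w (i + 1)) = rightWindow K w i := by
  funext d
  simp only [push, rightWindow]
  split_ifs with hd
  · rw [hd, show (i : ℤ) + 1 + (0 : ℕ) = (i + 1 : ℕ) by omega, look_natCast]
    simp [hi, hc (i + 1) hi]
  · congr 1; push_cast; omega

/-- The trellis automaton that performs a triangular computation on windows: its state on a
factor consists of the first letter, the last letter, and the value as a function of the left
and right contexts. -/
def windowTrellis {F : Type u} [Finite α] [Finite F] (K : ℕ) (β : Window α K → F)
    (g : F → F → F) (acc : Set F) : TrellisAutomaton α where
  Q := α × α × ((Fin K → Option α) → (Fin K → Option α) → F)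
  finite_Q := inferInstance
  letter := ⟨fun s => (s, s, fun l r => β (l, some s, r)), fun _ _ h => congrArg Prod.fst h⟩
  accept := {q | q.2.2 (fun _ => none) (fun _ => none) ∈ acc}
  δ p q := (p.1, q.2.1, fun l r => g (p.2.2 l (push q.2.1 r)) (q.2.2 (push p.1 l) r))

/-- Dropping the last letter of a factor adds it to the right context, and dropping the first adds
it to the left context. Storing these two letters in the state is therefore enough to evaluate both
subfactors in their true contexts. -/
theorem pyramid_windowTrellis {F : Type u} [Finite α] [Finite F] (K : ℕ) (β : Window α K → F)
    (g : F → F → F) (acc : Set F) {w : List α} {c : ℕ → α} (hc : Extends c w) (k : ℕ) :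
    ∀ i, i + k < w.length → ∃ φ,
      pyramid (windowTrellis K β g acc).letter (windowTrellis K β g acc).δ c k i =
        (c i, c (i + k), φ) ∧
      φ (leftWindow K w i) (rightWindow K w (i + k)) = pyramid β g (window K w) k i := by
  induction k with
  | zero =>
    intro i hi
    refine ⟨_, rfl, ?_⟩
    have : look w i = some (c i) := by rw [look_natCast]; simp [show i < w.length from hi, hc i hi]
    simp [pyramid, window, this]
  | succ k ih =>
    intro i hi
    obtain ⟨φ, h₁, h₂⟩ := ih i (by omega)
    obtain ⟨φ', h₁', h₂'⟩ := ih (i + 1) (by omega)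
    rw [show i + 1 + k = i + (k + 1) by omega] at h₁' h₂'
    refine ⟨_, by rw [pyramid, h₁, h₁']; rfl, ?_⟩
    rw [pyramid, push_leftWindow hc (by omega)]
    change g (φ _ (push (c (i + k + 1)) (rightWindow K w (i + k + 1)))) _ = _
    rw [push_rightWindow hc (by omega), h₂]
    exact congrArg _ h₂'

theorem mem_trellis_of_window {F : Type u} [Finite α] [Finite F] (K : ℕ) (β : Window α K → F)
    (g : F → F → F) (acc : Set F) (L : Language α)
    (hL : ∀ w, w ∈ L ↔ w ≠ [] ∧ pyramid β g (window K w) (w.length - 1) 0 ∈ acc) :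
    L ∈ Trellis α := by
  refine ⟨windowTrellis K β g acc, ?_⟩
  ext w
  by_cases hw : w = []
  · exact iff_of_false (fun h => TrellisAutomaton.ne_nil_of_mem_language _ h hw)
      fun h => ((hL w).1 h).1 hw
  obtain ⟨c, hc⟩ := exists_extends hw
  have hl := List.length_pos_of_ne_nil hw
  rw [hL, TrellisAutomaton.mem_language_iff _ hc]
  refine and_congr_right fun _ => ?_
  obtain ⟨φ, h₁, h₂⟩ := pyramid_windowTrellis K β g acc hc (w.length - 1) 0 (by omega)
  -- The whole word has empty contexts on both sides, which is what the acceptance condition of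
  -- `windowTrellis` plugs in.
  have hleft : leftWindow K w 0 = fun _ => none := by
    funext d; exact look_eq_none_iff.2 (by omega)
  have hright : rightWindow K w (0 + (w.length - 1)) = fun _ => none := by
    funext d; exact look_eq_none_iff.2 (by omega)
  rw [h₁, ← h₂, hleft, hright]
  rfl

/-- The neighborhoods of radius `m` of `i` in `w` and of `i'` in `w'` coincide. -/
def Agree (m : ℕ) (w : List α) (i : ℕ) (w' : List α) (i' : ℕ) : Prop :=
  ∀ d : ℤ, |d| ≤ m → look w (i + d) = look w' (i' + d)

theorem agree_of_window_eq {K : ℕ} {w w' : List α} {i i' : ℕ}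
    (h : window K w i = window K w' i') : Agree K w i w' i' := by
  intro d hd
  simp only [window, Prod.mk.injEq] at h
  obtain ⟨h₁, h₂, h₃⟩ := h
  rw [abs_le] at hd
  rcases lt_trichotomy d 0 with hlt | rfl | hgt
  · have := congrFun h₁ ⟨(-d - 1).toNat, by omega⟩
    simp only [leftWindow] at this
    convert this using 2 <;> omega
  · simpa using h₂
  · have := congrFun h₃ ⟨(d - 1).toNat, by omega⟩
    simp only [rightWindow] at this
    convert this using 2 <;> omega

/-! ### Neighborhoods under clamped shifts -/

namespace Agree

variable {m m' : ℕ} {w w' : List α} {i : Fin w.length} {i' : Fin w'.length}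

theorem symm (h : Agree m w i w' i') : Agree m w' i' w i := fun d hd => (h d hd).symm

theorem mono (hm : m' ≤ m) (h : Agree m w i w' i') : Agree m' w i w' i' :=
  fun d hd => h d (hd.trans (by exact_mod_cast hm))

/-- Radius 1 suffices to detect an end of the word, since `look` returns `none` just beyond it. -/
theorem last_iff (h : Agree (m + 1) w i w' i') :
    i.val + 1 = w.length ↔ i'.val + 1 = w'.length := by
  have := congrArg (· = none) (h 1 (by simp))
  simp only [look_eq_none_iff, eq_iff_iff] at this
  omega

theorem first_iff (h : Agree (m + 1) w i w' i') : i.val = 0 ↔ i'.val = 0 := by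
  have := congrArg (· = none) (h (-1) (by simp))
  simp only [look_eq_none_iff, eq_iff_iff] at this
  omega

/-- The ends of the words are visible, so the successor is clamped in both words or in neither; a
genuine move costs one unit of radius. -/
theorem suc (h : Agree (m + 1) w i w' i') :
    Agree m w (WordStructure.suc i : Fin _) w' (WordStructure.suc i' : Fin _) := by
  have hl := h.last_iff
  rw [val_suc, val_suc]
  split_ifs with h₁ h₂ h₂
  · intro d hd
    have := h (1 + d) ((abs_add_le _ _).trans (by rw [abs_one]; push_cast; omega))
    push_cast
    rwa [add_assoc, add_assoc]
  · omega
  · omega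
  · exact h.mono (by omega)

theorem pred (h : Agree (m + 1) w i w' i') :
    Agree m w (WordStructure.pred i : Fin _) w' (WordStructure.pred i' : Fin _) := by
  have hf := h.first_iff
  rw [val_pred, val_pred]
  by_cases h₀ : i.val = 0
  · rw [h₀, hf.1 h₀]
    have := h.mono (m' := m) (by omega)
    rwa [h₀, hf.1 h₀] at this
  · intro d hd
    have := h (-1 + d) ((abs_add_le _ _).trans (by rw [abs_neg, abs_one]; push_cast; omega))
    rw [show ((i.val - 1 : ℕ) : ℤ) + d = i + (-1 + d) by omega, this]
    congr 1
    omega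

theorem suc_iterate (k : ℕ) (h : Agree (m + k) w i w' i') :
    Agree m w (WordStructure.suc^[k] i : Fin _) w' (WordStructure.suc^[k] i' : Fin _) := by
  induction k generalizing i i' with
  | zero => exact h
  | succ k ih => exact ih (suc h)

theorem pred_iterate (k : ℕ) (h : Agree (m + k) w i w' i') :
    Agree m w (WordStructure.pred^[k] i : Fin _) w' (WordStructure.pred^[k] i' : Fin _) := by
  induction k generalizing i i' with
  | zero => exact h
  | succ k ih => exact ih (pred h)

theorem shift {a : ℤ} (h : Agree (m + a.natAbs) w i w' i') :
    Agree m w (WordStructure.shift a i : Fin _) w' (WordStructure.shift a i' : Fin _) := by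
  unfold WordStructure.shift
  split_ifs
  · exact suc_iterate _ (h.mono (by omega))
  · exact pred_iterate _ (h.mono (by omega))

theorem holds_iff (h : Agree (m + 1) w i w' i') (U : InputPred α) :
    U.Holds w i ↔ U.Holds w' i' := by
  cases U with
  | letter s =>
    have := h 0 (by rw [abs_zero]; positivity)
    simp only [add_zero, look_natCast, List.getElem?_eq_getElem i.2,
      List.getElem?_eq_getElem i'.2, Option.some.injEq] at this
    simp [InputPred.Holds, this]
  | min => exact h.first_iff
  | max => exact h.last_iff

end Agree

end Windows

/-! ### The least model of an inclusion Horn formula -/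

section LeastModel

variable {α R : Type u}

theorem InclHyp.Holds.mono {w : List α} {I J : R → Fin w.length → Fin w.length → Prop}
    (hIJ : ∀ S i j, I S i j → J S i j) {i j : Fin w.length} {h : InclHyp α R}
    (hh : h.Holds w I i j) : h.Holds w J i j := by
  cases h with
  | comp S a b => exact ⟨hIJ _ _ _ hh.1, hh.2⟩
  | _ => exact hh

/-- All hypotheses of `C` hold. -/
def InclClause.Fires (w : List α) (I : R → Fin w.length → Fin w.length → Prop)
    (i j : Fin w.length) (C : InclClause α R) : Prop :=
  ∀ h ∈ C.hyps, h.Holds w I i j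

/-- `I` satisfies the clauses of `Cs` whose conclusion is a computation atom. -/
def Closed (Cs : List (InclClause α R)) (w : List α)
    (I : R → Fin w.length → Fin w.length → Prop) : Prop :=
  ∀ i j, i ≤ j → ∀ C ∈ Cs, ∀ S, C.concl = .atom S → C.Fires w I i j → I S i j

/-- The least model of the clauses of `Cs` whose conclusion is a computation atom. -/
def Least (Cs : List (InclClause α R)) (w : List α) (S : R) (i j : Fin w.length) : Prop :=
  ∀ I, Closed Cs w I → I S i j

theorem closed_least (Cs : List (InclClause α R)) (w : List α) : Closed Cs w (Least Cs w) :=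
  fun i j hij C hC S hS hF I hI =>
    hI i j hij C hC S hS fun h hh => (hF h hh).mono fun _ _ _ hD => hD I hI

/-- A clause with conclusion `⊥` is violated at `(i, j)` in the least model. -/
def Conflict (Cs : List (InclClause α R)) (w : List α) (i j : Fin w.length) : Prop :=
  ∃ C ∈ Cs, C.concl = .bot ∧ C.Fires w (Least Cs w) i j

/-- Computation atoms occur only positively in hypotheses, so a clause that fires in the least model
fires in every model: if some model avoids ⊥, so does the least one. -/
theorem InclFormula.holds_iff (Φ : InclFormula α) (w : List α) :
    Φ.Holds w ↔ ∀ i j, i ≤ j → ¬ Conflict Φ.clauses w i j := by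
  constructor
  · rintro ⟨I, hI⟩ i j hij ⟨C, hC, hbot, hF⟩
    have hcl : Closed Φ.clauses w I := fun i j hij C hC S hS hF => by
      have := hI i j C hC hij hF
      rwa [hS] at this
    have := hI i j C hC hij fun h hh => (hF h hh).mono fun _ _ _ hD => hD I hcl
    rwa [hbot] at this
  · intro h
    refine ⟨Least Φ.clauses w, fun i j C hC hij hF => ?_⟩
    cases hS : C.concl with
    | atom S => exact closed_least _ _ i j hij C hC S hS hF
    | bot => exact h i j hij ⟨C, hC, hS, hF⟩

/-- A bound for the shifts in a hypothesis. -/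
def InclHyp.radius : InclHyp α R → ℕ
  | .pos _ _ a => a.natAbs
  | .neg _ _ a => a.natAbs
  | .comp _ a b => a + b
  | _ => 0

theorem exists_radius_le (Cs : List (InclClause α R)) :
    ∃ M, ∀ C ∈ Cs, ∀ h ∈ C.hyps, h.radius ≤ M :=
  ⟨((Cs.flatMap InclClause.hyps).map InclHyp.radius).sum, fun _ hC _ hh =>
    List.le_sum_of_mem (List.mem_map_of_mem (List.mem_flatMap.2 ⟨_, hC, hh⟩))⟩

/-- Radius M + 1 is needed because a shift by at most M must leave radius 1, in order to evaluate
`min` and `max` at the shifted position. -/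
theorem InclHyp.Holds.transfer {M : ℕ} {w w' : List α} {i j : Fin w.length}
    {i' j' : Fin w'.length} (hi : Agree (M + 1) w i w' i') (hj : Agree (M + 1) w j w' j')
    (hij' : i' ≤ j') (heq : i = j ↔ i' = j')
    {I : R → Fin w.length → Fin w.length → Prop}
    {I' : R → Fin w'.length → Fin w'.length → Prop}
    (hI : ∀ S a b, a ≤ M → b ≤ M → suc^[a] i ≤ pred^[b] j → I S (suc^[a] i) (pred^[b] j) →
      suc^[a] i' ≤ pred^[b] j' ∧ I' S (suc^[a] i') (pred^[b] j'))
    {h : InclHyp α R} (hr : h.radius ≤ M) (hh : h.Holds w I i j) : h.Holds w' I' i' j' := by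
  have key : ∀ (U : InputPred α) (v : FOVar) (a : ℤ), a.natAbs ≤ M →
      (U.Holds w (shift a (v.val i j)) ↔ U.Holds w' (shift a (v.val i' j'))) := by
    intro U v a ha
    cases v with
    | x => exact ((hi.mono (m' := 0 + 1 + a.natAbs) (by omega)).shift).holds_iff U
    | y => exact ((hj.mono (m' := 0 + 1 + a.natAbs) (by omega)).shift).holds_iff U
  cases h with
  | pos U v a => exact (key U v a hr).1 hh
  | neg U v a => exact (not_congr (key U v a hr)).1 hh
  | eq => exact heq.1 hh
  | lt => exact lt_of_le_of_ne hij' fun h => (ne_of_lt hh) (heq.2 h)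
  | comp S a b =>
    have hr : a + b ≤ M := hr
    obtain ⟨h₁, h₂⟩ := hI S a b (by omega) (by omega) hh.2 hh.1
    exact ⟨h₂, h₁⟩

/-- The surroundings of `(i, j)` in `w` and of `(i', j')` in `w'`, on which the least model
at these points depends, coincide. -/
structure SimilarCells (Cs : List (InclClause α R)) (M : ℕ) {w w' : List α} (i j : Fin w.length)
    (i' j' : Fin w'.length) : Prop where
  agree_left : Agree (M + 1) w i w' i'
  agree_right : Agree (M + 1) w j w' j'
  le : i ≤ j
  le' : i' ≤ j'
  eq_iff : i = j ↔ i' = j'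
  inner : ∀ a b, a ≤ M → b ≤ M →
    ((suc^[a] i = i ∧ pred^[b] j = j) ∧ (suc^[a] i' = i' ∧ pred^[b] j' = j')) ∨
    (¬ (suc^[a] i = i ∧ pred^[b] j = j) ∧ ¬ (suc^[a] i' = i' ∧ pred^[b] j' = j') ∧
      ∀ S, (suc^[a] i ≤ pred^[b] j ∧ Least Cs w S (suc^[a] i) (pred^[b] j)) ↔
        (suc^[a] i' ≤ pred^[b] j' ∧ Least Cs w' S (suc^[a] i') (pred^[b] j')))

/-! ### Transfer of the least model between similar cells -/

namespace SimilarCells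

variable {Cs : List (InclClause α R)} {M : ℕ} {w w' : List α} {i j : Fin w.length}
  {i' j' : Fin w'.length}

theorem symm (h : SimilarCells Cs M i j i' j') : SimilarCells Cs M i' j' i j where
  agree_left := h.agree_left.symm
  agree_right := h.agree_right.symm
  le := h.le'
  le' := h.le
  eq_iff := h.eq_iff.symm
  inner a b ha hb := by
    rcases h.inner a b ha hb with ⟨h₁, h₂⟩ | ⟨h₁, h₂, h₃⟩
    · exact .inl ⟨h₂, h₁⟩
    · exact .inr ⟨h₂, h₁, fun S => (h₃ S).symm⟩

/-- Atoms at the cell itself, possibly reached through clamping, are isolated in `hself`; `inner`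
handles all the others. Allowing `I` to lie below the least model makes this usable inside the
minimality argument of `least`. -/
theorem fires (h : SimilarCells Cs M i j i' j')
    {I : R → Fin w.length → Fin w.length → Prop} (hI : ∀ S k l, I S k l → Least Cs w S k l)
    (hself : ∀ S, I S i j → Least Cs w' S i' j') {C : InclClause α R}
    (hC : ∀ h ∈ C.hyps, h.radius ≤ M) (hF : C.Fires w I i j) :
    C.Fires w' (Least Cs w') i' j' := by
  refine fun p hp => (hF p hp).transfer h.agree_left h.agree_right h.le' h.eq_iff
    (fun S a b ha hb hle hS => ?_) (hC p hp)
  rcases h.inner a b ha hb with ⟨⟨h₁, h₂⟩, h₁', h₂'⟩ | ⟨-, -, h₃⟩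
  · rw [h₁, h₂] at hS
    rw [h₁', h₂']
    exact ⟨h.le', hself S hS⟩
  · exact (h₃ S).1 ⟨hle, hI _ _ _ hS⟩

theorem least (h : SimilarCells Cs M i j i' j') (hM : ∀ C ∈ Cs, ∀ h ∈ C.hyps, h.radius ≤ M) {S : R}
    (hS : Least Cs w S i j) : Least Cs w' S i' j' := by
  -- Induction on derivations, phrased as minimality: the least model is contained in its
  -- restriction to those atoms which, when located at (i, j), also hold at (i', j'), once this
  -- restriction is shown to be closed.
  refine (hS (fun S k l => Least Cs w S k l ∧ (k = i → l = j → Least Cs w' S i' j')) ?_).2 rfl rfl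
  intro k l hkl C hC S hCS hF
  refine ⟨closed_least Cs w k l hkl C hC S hCS fun p hp => (hF p hp).mono fun _ _ _ h => h.1, ?_⟩
  rintro rfl rfl
  exact closed_least Cs w' i' j' h.le' C hC S hCS
    (h.fires (fun _ _ _ h => h.1) (fun _ h => h.2 rfl rfl) (hM C hC) hF)

theorem least_iff (h : SimilarCells Cs M i j i' j') (hM : ∀ C ∈ Cs, ∀ h ∈ C.hyps, h.radius ≤ M)
    (S : R) : Least Cs w S i j ↔ Least Cs w' S i' j' :=
  ⟨h.least hM, h.symm.least hM⟩

theorem conflict (h : SimilarCells Cs M i j i' j') (hM : ∀ C ∈ Cs, ∀ h ∈ C.hyps, h.radius ≤ M)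
    (hc : Conflict Cs w i j) : Conflict Cs w' i' j' := by
  obtain ⟨C, hC, hbot, hF⟩ := hc
  exact ⟨C, hC, hbot, h.fires (fun _ _ _ h => h) (fun _ h' => h.least hM h') (hM C hC) hF⟩

theorem conflict_iff (h : SimilarCells Cs M i j i' j') (hM : ∀ C ∈ Cs, ∀ h ∈ C.hyps, h.radius ≤ M) :
    Conflict Cs w i j ↔ Conflict Cs w' i' j' :=
  ⟨h.conflict hM, h.symm.conflict hM⟩

end SimilarCells

end LeastModel

/-! ### From inclusion Horn formulas to trellis automata -/

section Values

variable {α R : Type u}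

theorem WordStructure.val_suc_iterate {n : ℕ} (a : ℕ) (i : Fin n) :
    (suc^[a] i).val = min (i.val + a) (n - 1) := by
  induction a with
  | zero => simp; omega
  | succ a ih => rw [Function.iterate_succ_apply', val_suc, ih]; split_ifs <;> omega

theorem WordStructure.val_pred_iterate {n : ℕ} (b : ℕ) (j : Fin n) :
    (pred^[b] j).val = j.val - b := by
  induction b with
  | zero => simp
  | succ b ih => rw [Function.iterate_succ_apply', val_pred, ih]; omega

/-- The information on the least model at `(i, j)` and inside `[i, j]` that determines the
information at the points above `(i, j)`. -/
abbrev Value (α R : Type u) (M : ℕ) : Type u :=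
  Window α (M + 1) × Window α (M + 1) × (Fin (M + 1) → Fin (M + 1) → Set R) × Prop

/-- A clause with conclusion `⊥` is violated inside `[i, j]`. -/
def ConflictWithin (Cs : List (InclClause α R)) (w : List α) (i j : Fin w.length) : Prop :=
  ∃ k l, i ≤ k ∧ k ≤ l ∧ l ≤ j ∧ Conflict Cs w k l

/-- The value of the least model at `(i, j)`. -/
def leastValue (Cs : List (InclClause α R)) (M : ℕ) (w : List α) (i j : Fin w.length) :
    Value α R M :=
  (window (M + 1) w i, window (M + 1) w j,
    fun a b => {S | suc^[a.val] i ≤ pred^[b.val] j ∧ Least Cs w S (suc^[a.val] i) (pred^[b.val] j)},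
    ConflictWithin Cs w i j)

variable {Cs : List (InclClause α R)} {M : ℕ} {w w' : List α} {i j : Fin w.length}
  {i' j' : Fin w'.length}

/-! ### Locality of the values of the least model -/

theorem conflictWithin_self_iff : ConflictWithin Cs w i i ↔ Conflict Cs w i i := by
  constructor
  · rintro ⟨k, l, h₁, h₂, h₃, h⟩
    obtain rfl : k = i := le_antisymm (h₂.trans h₃) h₁
    obtain rfl : l = k := le_antisymm h₃ h₂
    exact h
  · exact fun h => ⟨i, i, le_rfl, le_rfl, le_rfl, h⟩

/-- The triangle of subintervals of [i, j] is the union of the triangles below (i, j-1) and (i+1, j)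
and of its apex. -/
theorem conflictWithin_iff_of_lt (hij : i < j) : ConflictWithin Cs w i j ↔
    ConflictWithin Cs w i (pred j) ∨ ConflictWithin Cs w (suc i) j ∨ Conflict Cs w i j := by
  have hlt : i.val < j.val := hij
  have hj := j.2
  have hs := val_suc i
  rw [if_pos (by omega)] at hs
  have hp := val_pred j
  constructor
  · rintro ⟨k, l, h₁, h₂, h₃, h⟩
    by_cases hl : l = j
    · by_cases hk : k = i
      · subst hl hk; exact .inr (.inr h)
      · refine .inr (.inl ⟨k, l, ?_, h₂, h₃, h⟩)
        rw [Fin.le_def] at *; rw [Fin.ext_iff] at hk; omega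
    · refine .inl ⟨k, l, h₁, h₂, ?_, h⟩
      rw [Fin.le_def] at *; rw [Fin.ext_iff] at hl; omega
  · rintro (⟨k, l, h₁, h₂, h₃, h⟩ | ⟨k, l, h₁, h₂, h₃, h⟩ | h)
    · refine ⟨k, l, h₁, h₂, ?_, h⟩
      rw [Fin.le_def] at *; omega
    · refine ⟨k, l, ?_, h₂, h₃, h⟩
      rw [Fin.le_def] at *; omega
    · exact ⟨i, j, le_rfl, hij.le, le_rfl, h⟩

/-- On the diagonal, shifted terms either both stay at i or cross, violating x + a ≤ y - b. No atom
at another cell is ever consulted, and the window tells which case occurs. -/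
theorem similarCells_self (h : window (M + 1) w i = window (M + 1) w' i') :
    SimilarCells Cs M i i i' i' := by
  have hA := agree_of_window_eq h
  refine ⟨hA, hA, le_rfl, le_rfl, by simp, fun a b _ _ => ?_⟩
  have hl := hA.last_iff
  have hf := hA.first_iff
  simp only [Fin.ext_iff, Fin.le_def, val_suc_iterate, val_pred_iterate]
  have hi := i.2
  have hi' := i'.2
  by_cases hs : (a = 0 ∨ i.val + 1 = w.length) ∧ (b = 0 ∨ i.val = 0)
  · left; omega
  · right
    refine ⟨by omega, by omega, fun S => iff_of_false (fun h => ?_) (fun h => ?_)⟩ <;>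
    · have := h.1
      omega

theorem similarCells_of_lt (hij : i < j) (hij' : i' < j')
    (h₁ : leastValue Cs M w i (pred j) = leastValue Cs M w' i' (pred j'))
    (h₂ : leastValue Cs M w (suc i) j = leastValue Cs M w' (suc i') j') :
    SimilarCells Cs M i j i' j' := by
  refine ⟨agree_of_window_eq (congrArg Prod.fst h₁),
    agree_of_window_eq (congrArg (fun v => v.2.1) h₂), hij.le, hij'.le,
    iff_of_false hij.ne hij'.ne, fun a b ha hb => ?_⟩
  have hlt : i.val < j.val := hij
  have hj := j.2
  have hlt' : i'.val < j'.val := hij'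
  have hj' := j'.2
  -- When i < j, i is not last and j is not first, so any nonzero shift really moves.
  have hself : ∀ {u : List α} {i j : Fin u.length}, i.val < j.val → ¬ (a = 0 ∧ b = 0) →
      ¬ (suc^[a] i = i ∧ pred^[b] j = j) := by
    intro u i j hlt h
    have := j.2
    rw [Fin.ext_iff, Fin.ext_iff, val_suc_iterate, val_pred_iterate]
    omega
  by_cases h₀ : a = 0 ∧ b = 0
  · obtain ⟨rfl, rfl⟩ := h₀
    exact .inl ⟨⟨rfl, rfl⟩, rfl, rfl⟩
  refine .inr ⟨hself hlt h₀, hself hlt' h₀, fun S => ?_⟩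
  -- If b > 0, the cell (i+a, j-b) is read from the value at (i, j-1) with indices (a, b-1);
  -- otherwise a > 0 and it is read from the value at (i+1, j) with indices (a-1, 0). The reduced
  -- indices stay within the stored range.
  rcases b with _ | b
  · obtain ⟨a, rfl⟩ : ∃ m, a = m + 1 := ⟨a - 1, by omega⟩
    have := congrArg (fun v => S ∈ v.2.2.1 ⟨a, by omega⟩ ⟨0, by omega⟩) h₂
    exact iff_of_eq this
  · have := congrArg (fun v => S ∈ v.2.2.1 ⟨a, by omega⟩ ⟨b, by omega⟩) h₁
    exact iff_of_eq this

theorem SimilarCells.leastValue_eq (h : SimilarCells Cs M i j i' j')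
    (hM : ∀ C ∈ Cs, ∀ h ∈ C.hyps, h.radius ≤ M)
    (hi : window (M + 1) w i = window (M + 1) w' i')
    (hj : window (M + 1) w j = window (M + 1) w' j')
    (hc : ConflictWithin Cs w i j ↔ ConflictWithin Cs w' i' j') :
    leastValue Cs M w i j = leastValue Cs M w' i' j' := by
  unfold leastValue
  rw [hi, hj, propext hc]
  congr 3
  funext a b
  ext S
  rcases h.inner a b (by omega) (by omega) with ⟨⟨h₁, h₂⟩, h₁', h₂'⟩ | ⟨-, -, h₃⟩
  · simp only [Set.mem_ofPred_eq, h₁, h₂, h₁', h₂', h.le, h.le', true_and]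
    exact h.least_iff hM S
  · exact h₃ S

theorem leastValue_self_eq (hM : ∀ C ∈ Cs, ∀ h ∈ C.hyps, h.radius ≤ M)
    (h : window (M + 1) w i = window (M + 1) w' i') :
    leastValue Cs M w i i = leastValue Cs M w' i' i' := by
  have hs := similarCells_self (Cs := Cs) h
  refine hs.leastValue_eq hM h h ?_
  rw [conflictWithin_self_iff, conflictWithin_self_iff, hs.conflict_iff hM]

theorem leastValue_eq_of_lt (hM : ∀ C ∈ Cs, ∀ h ∈ C.hyps, h.radius ≤ M)
    (hij : i < j) (hij' : i' < j')
    (h₁ : leastValue Cs M w i (pred j) = leastValue Cs M w' i' (pred j'))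
    (h₂ : leastValue Cs M w (suc i) j = leastValue Cs M w' (suc i') j') :
    leastValue Cs M w i j = leastValue Cs M w' i' j' := by
  have hs := similarCells_of_lt hij hij' h₁ h₂
  refine hs.leastValue_eq hM (congrArg Prod.fst h₁) (congrArg (fun v => v.2.1) h₂) ?_
  rw [conflictWithin_iff_of_lt hij, conflictWithin_iff_of_lt hij', hs.conflict_iff hM,
    iff_of_eq (congrArg (fun v => v.2.2.2) h₁ : ConflictWithin Cs w i (pred j) = _),
    iff_of_eq (congrArg (fun v => v.2.2.2) h₂ : ConflictWithin Cs w (suc i) j = _)]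
  rfl

/-- The values of the least model are obtained by a triangular computation on windows. -/
theorem exists_pyramid_leastValue (hM : ∀ C ∈ Cs, ∀ h ∈ C.hyps, h.radius ≤ M) :
    ∃ (β : Window α (M + 1) → Value α R M) (g : Value α R M → Value α R M → Value α R M),
      ∀ (w : List α) (k i : ℕ) (h : i + k < w.length),
        pyramid β g (window (M + 1) w) k i = leastValue Cs M w ⟨i, by omega⟩ ⟨i + k, h⟩ := by
  -- The base and transition functions are not constructed: equal inputs give equal values across
  -- all words, so they exist by factorization, and are extended arbitrarily to inputs that never
  -- occur.
  have : Nonempty (Value α R M) :=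
    ⟨((fun _ => none, none, fun _ => none), (fun _ => none, none, fun _ => none),
      fun _ _ => ∅, False)⟩
  obtain ⟨β, hβ⟩ := (Function.factorsThrough_iff
    (f := fun p : Σ w : List α, Fin w.length => window (M + 1) p.1 p.2)
    (fun p : Σ w : List α, Fin w.length => leastValue Cs M p.1 p.2 p.2)).1
    fun p p' h => leastValue_self_eq hM h
  obtain ⟨g, hg⟩ := (Function.factorsThrough_iff
    (f := fun p : Σ w : List α, {q : Fin w.length × Fin w.length // q.1 < q.2} =>
      (leastValue Cs M p.1 p.2.1.1 (pred p.2.1.2), leastValue Cs M p.1 (suc p.2.1.1) p.2.1.2))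
    (fun p : Σ w : List α, {q : Fin w.length × Fin w.length // q.1 < q.2} =>
      leastValue Cs M p.1 p.2.1.1 p.2.1.2)).1
    fun p p' h => leastValue_eq_of_lt hM p.2.2 p'.2.2 (congrArg Prod.fst h) (congrArg Prod.snd h)
  refine ⟨β, fun p q => g (p, q), fun w k => ?_⟩
  induction k with
  | zero => exact fun i h => (congrFun hβ ⟨w, ⟨i, h⟩⟩).symm
  | succ k ih =>
    intro i h
    have e₁ : pred (⟨i + (k + 1), h⟩ : Fin w.length) = ⟨i + k, by omega⟩ := by
      ext; simp [val_pred]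
    have e₂ : suc (⟨i, by omega⟩ : Fin w.length) = ⟨i + 1, by omega⟩ := by
      ext; simp [val_suc]; omega
    have := congrFun hg ⟨w, ⟨(⟨i, by omega⟩, ⟨i + (k + 1), h⟩), by simp [Fin.lt_def]⟩⟩
    simp only [Function.comp_apply, e₁, e₂] at this
    rw [pyramid, this, ih i (by omega), ih (i + 1) (by omega)]
    simp only [show i + 1 + k = i + (k + 1) by omega]

theorem inclESOHorn_subset_trellis (α : Type u) [Finite α] : inclESOHorn α ⊆ Trellis α := by
  rintro _ ⟨Φ, rfl⟩
  have := Φ.finite_R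
  obtain ⟨M, hM⟩ := exists_radius_le Φ.clauses
  obtain ⟨β, g, h⟩ := exists_pyramid_leastValue hM
  -- At the apex, the last component records conflicts in the whole word; the formula holds iff
  -- there is none.
  refine mem_trellis_of_window (M + 1) β g {v | ¬ v.2.2.2} _ fun w => and_congr_right fun hw => ?_
  have hl := List.length_pos_of_ne_nil hw
  rw [h w (w.length - 1) 0 (by omega), Φ.holds_iff]
  change _ ↔ ¬ ConflictWithin _ _ _ _
  simp only [ConflictWithin, not_exists, not_and]
  refine ⟨fun H i j _ hij _ => H i j hij, fun H i j hij => H i j ?_ hij ?_⟩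
  · simp [Fin.le_def]
  · simp only [Fin.le_def]; omega

theorem trellis_subset_inclESOHorn (α : Type u) [Finite α] : Trellis α ⊆ inclESOHorn α := by
  rintro _ ⟨A, rfl⟩
  exact A.exists_formula

end Values

theorem mainTheorem3 (α : Type u) [Finite α] :
    inclESOHorn α = Trellis α ∧ Trellis α = RealTimeOCA α :=
  ⟨(inclESOHorn_subset_trellis α).antisymm (trellis_subset_inclESOHorn α),
    (trellis_subset_realTimeOCA α).antisymm (realTimeOCA_subset_trellis α)⟩
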